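/- \textbf{Theorem.} For a probability measure $P_0$ on $\mathbb{R}$ with mean $\mu_0$, let $(P_\beta)$ be the exponential family $\frac{dP_\beta}{dP_0}(x)=\frac{\exp(\beta x)}{Z(\beta)}$, $Z(\beta)=\int \exp(\beta x)\,dP_0(x)<\infty$, completed by the (setwise) limits of $P_\beta$ as $\beta\to\pm\infty$ when these limits exist as probability measures. Let $P^x$ denote the member of this family with mean $x$, and let $D(P^x\Vert P_0)$ be the information (Kullback--Leibler) divergence, with $D(P^x\Vert P_0)=\infty$ if there is no such member. The $G$-transform of a random variable with distribution $P_0$ is \[ G(x)=\begin{cases}-\left(2D(P^x\Vert P_0)\right)^{1/2}, & x<\mu_0,\\ \left(2D(P^x\Vert P_0)\right)^{1/2}, & x\ge\mu_0.\end{cases} \] Let $\Phi$ be the standard normal distribution function, with $\Phi(-\infty)=0$ and $\Phi(\infty)=1$. Let $M$ be a Poisson distributed random variable with mean $t>0$, and let $G$ be its $G$-transform. Then $M$ has the intersection property: for every integer $m\ge 0$, \[ P(M<m)<\Phi(G(m))<P(M\le m), \] and hence, for every integer $m$, \[ P(M<m)\le\Phi(G(m))\le P(M\le m) \] (for $m<0$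 one has $G(m)=-\infty$ and all three terms are $0$). -/

import Mathlib

open MeasureTheory ProbabilityTheory Filter Topology
open scoped ENNReal NNReal

noncomputable section

/-- `Q` is a member of the one-dimensional (natural) exponential family based on the probability
measure `P₀`.  Either `dQ/dP₀ (x) = exp (β x) / Z(β)` for some `β` with `Z(β) < ∞`, or `Q` is a
limiting member: the setwise limit of `P_β` as `β → -∞` or as `β → ∞`.  (For a
Poisson law the limiting member `β → -∞` is the Poisson law with mean `0`.) -/
def IsExpFamilyMember (P₀ Q : Measure ℝ) : Prop :=
  IsProbabilityMeasure Q ∧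
    ((∃ β : ℝ, Integrable (fun x => Real.exp (β * x)) P₀ ∧ Q = P₀.tilted (fun x => β * x)) ∨
      (∀ s, MeasurableSet s →
        Tendsto (fun β : ℝ => P₀.tilted (fun x => β * x) s) atBot (𝓝 (Q s))) ∨
      (∀ s, MeasurableSet s →
        Tendsto (fun β : ℝ => P₀.tilted (fun x => β * x) s) atTop (𝓝 (Q s))))

/-- The information divergence `D(P^x ‖ P₀)`, where `P^x` is the member of the exponential family
based on `P₀` that has mean `x`.  There is at most one such member, so the infimum only serves to
pick it out; if there is none, the value is `∞`. -/
def divergenceAtMean (P₀ : Measure ℝ) (x : ℝ) : ℝ≥0∞ :=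
  ⨅ (Q : Measure ℝ) (_ : IsExpFamilyMember P₀ Q) (_ : Integrable (fun y => y) Q)
    (_ : ∫ y, y ∂Q = x), InformationTheory.klDiv Q P₀

/-- The `G`-transform belonging to the distribution `P₀`, a function with values in `[-∞, ∞]`. -/
def gTransform (P₀ : Measure ℝ) (x : ℝ) : EReal :=
  if x < ∫ y, y ∂P₀ then -(((2 * divergenceAtMean P₀ x) ^ (1 / 2 : ℝ) : ℝ≥0∞) : EReal)
  else (((2 * divergenceAtMean P₀ x) ^ (1 / 2 : ℝ) : ℝ≥0∞) : EReal)

/-- The distribution function `Φ(g) = P(Z ≤ g)` of a standard Gaussian `Z`, for `g ∈ [-∞, ∞]`. -/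
def stdGaussianCDF (g : EReal) : ℝ :=
  (gaussianReal 0 1).real {z : ℝ | (z : EReal) ≤ g}

end

/-! ### Functions whose derivative changes sign once -/

section SignChange

/-! Fix the integer `n ≥ 0` and let the mean `t` vary. Write D for the divergence of Poisson(n) from
Poisson(t), and G for its signed root, so that G² = 2D. The Gaussian density at G is a constant
times e^{-t} t^n (`gaussianPDFReal_poissonSignedRoot`), and the t-derivative of a Poisson tail is
also a single term of the form e^{-t} t^k (`hasDerivAt_poissonLT`). So the derivative of either
difference between Φ(G) and a tail is a positive weight times A - f(t). For the lower bound f is a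
multiple of (n - t)/G; for the upper bound it is a negative multiple of (n - t)/(tG).

Both choices of f increase, because D/(t - n)² decreases in t while t² D/(t - n)² increases; for n >
0 this is read off an integral formula (`integral_div_eq_poissonDivergence_div`). Each difference
therefore cannot rise again once it falls. Its limits are nonnegative at 0 and zero at ∞, so it is
positive (`pos_of_hasDerivAt_mul_sub`).

The rest identifies the abstract G-transform with G: the exponential family of a Poisson law
consists of all Poisson laws, mean 0 included. -/

lemma lt_of_hasDerivAt_pos_of_ne {H H' : ℝ → ℝ} {x y c : ℝ} (hxy : x < y)
    (hcont : ContinuousOn H (Set.Icc x y))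
    (hder : ∀ z ∈ Set.Ioo x y, z ≠ c → HasDerivAt H (H' z) z)
    (hpos : ∀ z ∈ Set.Ioo x y, z ≠ c → 0 < H' z) : H x < H y := by
  have base : ∀ a b, a < b → x ≤ a → b ≤ y → c ∉ Set.Ioo a b → H a < H b := by
    intro a b hab hxa hby hc
    have hne : ∀ z ∈ Set.Ioo a b, z ∈ Set.Ioo x y ∧ z ≠ c := fun z hz =>
      ⟨⟨hxa.trans_lt hz.1, hz.2.trans_le hby⟩, fun h => hc (h ▸ hz)⟩
    refine strictMonoOn_of_deriv_pos (convex_Icc a b)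
      (hcont.mono (Set.Icc_subset_Icc hxa hby)) (fun z hz => ?_)
      (Set.left_mem_Icc.2 hab.le) (Set.right_mem_Icc.2 hab.le) hab
    rw [interior_Icc] at hz
    rw [(hder z (hne z hz).1 (hne z hz).2).deriv]
    exact hpos z (hne z hz).1 (hne z hz).2
  -- The exceptional point is harmless: strict increase on both sides of `c` is glued using
  -- continuity there.
  by_cases hc : c ∈ Set.Ioo x y
  · exact (base x c hc.1 le_rfl hc.2.le (by simp)).trans (base c y hc.2 hc.1.le le_rfl (by simp))
  · exact base x y hxy le_rfl le_rfl hc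

/-- A function on `(0, ∞)` with nonnegative limits at both ends, whose derivative changes sign from
positive to negative, is positive. -/
lemma pos_of_hasDerivAt_mul_sub {H w f : ℝ → ℝ} {A c L : ℝ} (hcont : ContinuousOn H (Set.Ioi 0))
    (hder : ∀ t, 0 < t → t ≠ c → HasDerivAt H (w t * (A - f t)) t)
    (hw : ∀ t, 0 < t → 0 < w t)
    (hf : ∀ s t, 0 < s → s < t → s ≠ c → t ≠ c → f s < f t)
    (h0 : Tendsto H (𝓝[>] 0) (𝓝 L)) (hL : 0 ≤ L) (hinf : Tendsto H atTop (𝓝 0))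
    {t : ℝ} (ht : 0 < t) : 0 < H t := by
  have exists_between_ne : ∀ a b : ℝ, a < b → ∃ z, a < z ∧ z < b ∧ z ≠ c := by
    intro a b hab
    obtain ⟨z, hz1, hz2⟩ := exists_between hab
    obtain ⟨z', hz1', hz2'⟩ := exists_between hz2
    by_cases h : z = c
    · exact ⟨z', hz1.trans hz1', hz2', fun h' => by linarith⟩
    · exact ⟨z, hz1, hz2, h⟩
  -- Either `H` has been rising from its limit at 0 all the way to `t`, or `f` exceeded `A` before
  -- `t` and `H` falls from `t` on towards 0.
  by_cases hA : ∀ s, 0 < s → s < t → s ≠ c → f s ≤ A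
  · have hlt : ∀ s, 0 < s → s < t → s ≠ c → f s < A := by
      intro s hs hst hsc
      obtain ⟨z, hz1, hz2, hzc⟩ := exists_between_ne s t hst
      exact (hf s z hs hz1 hsc hzc).trans_le (hA z (hs.trans hz1) hz2 hzc)
    have mono : ∀ x y, 0 < x → x < y → y ≤ t → H x < H y := by
      intro x y hx hxy hy
      refine lt_of_hasDerivAt_pos_of_ne hxy
        (hcont.mono fun z hz => hx.trans_le hz.1)
        (fun z hz hzc => hder z (hx.trans hz.1) hzc) (fun z hz hzc => ?_)
      have hz0 := hx.trans hz.1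
      exact mul_pos (hw z hz0) (sub_pos.2 (hlt z hz0 (hz.2.trans_le hy) hzc))
    have h1 : L ≤ H (t / 2) := by
      refine le_of_tendsto h0 ?_
      filter_upwards [Ioo_mem_nhdsGT (half_pos ht)] with x hx
      exact (mono x _ hx.1 hx.2 (by linarith)).le
    linarith [mono (t / 2) t (by linarith) (by linarith) le_rfl]
  · push Not at hA
    obtain ⟨s, hs, hst, hsc, hsA⟩ := hA
    have anti : ∀ x y, s ≤ x → x < y → H y < H x := by
      intro x y hx hxy
      have := lt_of_hasDerivAt_pos_of_ne (H := fun z => -H z)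
        (H' := fun z => -(w z * (A - f z))) (c := c) hxy
        (hcont.mono fun z hz => (hs.trans_le hx).trans_le hz.1).neg
        (fun z hz hzc => (hder z ((hs.trans_le hx).trans hz.1) hzc).neg) (fun z hz hzc => ?_)
      · simpa using this
      have hz0 := (hs.trans_le hx).trans hz.1
      have := hf s z hs (hx.trans_lt hz.1) hsc hzc
      rw [← mul_neg]
      exact mul_pos (hw z hz0) (by linarith)
    have h1 : 0 ≤ H (t + 1) := by
      refine le_of_tendsto hinf ?_
      filter_upwards [eventually_gt_atTop (t + 1)] with y hy using (anti _ _ (by linarith) hy).le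
    linarith [anti t (t + 1) hst.le (by linarith)]

end SignChange

/-! ### The divergence between two Poisson laws -/

noncomputable section

/-- The divergence of the Poisson law with mean `m` from the Poisson law with mean `t`. -/
def poissonDivergence (m t : ℝ) : ℝ := m * Real.log (m / t) - m + t

lemma poissonDivergence_eq (m : ℝ) {t : ℝ} (ht : 0 < t) :
    poissonDivergence m t = m * Real.log m - m * Real.log t - m + t := by
  rcases eq_or_ne m 0 with rfl | hm
  · simp [poissonDivergence]
  · rw [poissonDivergence, Real.log_div hm ht.ne']; ring

@[simp] lemma poissonDivergence_zero_left (t : ℝ) : poissonDivergence 0 t = t := by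
  simp [poissonDivergence]

lemma poissonDivergence_self (m : ℝ) : poissonDivergence m m = 0 := by
  rcases eq_or_ne m 0 with rfl | hm <;> simp [poissonDivergence, *]

lemma hasDerivAt_poissonDivergence (m : ℝ) {t : ℝ} (ht : 0 < t) :
    HasDerivAt (poissonDivergence m) (1 - m / t) t := by
  have h : HasDerivAt (fun t => m * Real.log m - m * Real.log t - m + t) (-(m * t⁻¹) + 1) t := by
    exact ((((Real.hasDerivAt_log ht.ne').const_mul m).const_sub
      (m * Real.log m)).sub_const m).add (hasDerivAt_id t)
  refine (h.congr_of_eventuallyEq ?_).congr_deriv (by ring)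
  filter_upwards [lt_mem_nhds ht] with s hs using poissonDivergence_eq m hs

lemma poissonDivergence_pos {m t : ℝ} (hm : 0 ≤ m) (ht : 0 < t) (h : t ≠ m) :
    0 < poissonDivergence m t := by
  rcases hm.eq_or_lt with rfl | hm
  · simpa using ht
  · have h1 : Real.log (t / m) < t / m - 1 :=
      Real.log_lt_sub_one_of_pos (by positivity) (by rwa [Ne, div_eq_one_iff_eq hm.ne'])
    rw [Real.log_div ht.ne' hm.ne'] at h1
    have h2 := mul_lt_mul_of_pos_left h1 hm
    rw [mul_sub, mul_sub, mul_div_cancel₀ _ hm.ne'] at h2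
    rw [poissonDivergence_eq m ht]
    linarith

lemma poissonDivergence_nonneg {m t : ℝ} (hm : 0 ≤ m) (ht : 0 < t) :
    0 ≤ poissonDivergence m t := by
  rcases eq_or_ne t m with rfl | h
  · rw [poissonDivergence_self]
  · exact (poissonDivergence_pos hm ht h).le

lemma add_mul_sub_pos {m t s : ℝ} (hm : 0 < m) (ht : 0 < t) (hs : s ∈ Set.Icc (0 : ℝ) 1) :
    0 < m + s * (t - m) := by
  rcases hs.1.eq_or_lt with rfl | hs0
  · simpa using hm
  · nlinarith [mul_pos hs0 ht, mul_nonneg (sub_nonneg.2 hs.2) hm.le]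

lemma continuousOn_div_add_mul_sub {m t : ℝ} (hm : 0 < m) (ht : 0 < t) :
    ContinuousOn (fun s => s / (m + s * (t - m))) (Set.Icc 0 1) := fun s hs => by
  have hs' := (add_mul_sub_pos hm ht hs).ne'
  exact (by fun_prop (disch := assumption) :
    ContinuousAt (fun s => s / (m + s * (t - m))) s).continuousWithinAt

/-- This integrates the derivative 1 - m/u of the divergence along the segment u = m + s(t - m). It
moves all dependence on `t` into an integrand whose monotonicity is elementary. -/
lemma integral_div_eq_poissonDivergence_div {m t : ℝ} (hm : 0 < m) (ht : 0 < t) (h : t ≠ m) :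
    ∫ s in (0 : ℝ)..1, s / (m + s * (t - m)) = poissonDivergence m t / (t - m) ^ 2 := by
  have htm : t - m ≠ 0 := sub_ne_zero.2 h
  have hd : ∀ s ∈ Set.uIcc (0 : ℝ) 1, HasDerivAt
      (fun s => s / (t - m) - m * Real.log (m + s * (t - m)) / (t - m) ^ 2)
      (s / (m + s * (t - m))) s := by
    intro s hs
    rw [Set.uIcc_of_le zero_le_one] at hs
    have hs' := (add_mul_sub_pos hm ht hs).ne'
    have h1 : HasDerivAt (fun s : ℝ => m + s * (t - m)) (1 * (t - m)) s :=
      ((hasDerivAt_id s).mul_const _).const_add m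
    refine (((hasDerivAt_id s).div_const (t - m)).sub
      (((h1.log hs').const_mul m).div_const ((t - m) ^ 2))).congr_deriv ?_
    rw [one_mul, mul_div_assoc', div_div, div_sub_div _ _ htm (by positivity),
      div_eq_div_iff (by positivity) hs']
    ring
  rw [intervalIntegral.integral_eq_sub_of_hasDerivAt hd]
  · rw [poissonDivergence_eq m ht]
    simp only [one_mul, zero_mul, zero_div, add_zero, add_sub_cancel]
    field_simp
    ring
  · refine ContinuousOn.intervalIntegrable ?_
    rw [Set.uIcc_of_le zero_le_one]
    exact continuousOn_div_add_mul_sub hm ht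

lemma poissonDivergence_div_sq_strictAnti {m t u : ℝ} (hm : 0 < m) (ht : 0 < t) (htu : t < u)
    (htm : t ≠ m) (hum : u ≠ m) :
    poissonDivergence m u / (u - m) ^ 2 < poissonDivergence m t / (t - m) ^ 2 := by
  have hu := ht.trans htu
  rw [← integral_div_eq_poissonDivergence_div hm ht htm,
    ← integral_div_eq_poissonDivergence_div hm hu hum]
  refine intervalIntegral.integral_lt_integral_of_continuousOn_of_le_of_exists_lt one_pos
    (continuousOn_div_add_mul_sub hm hu) (continuousOn_div_add_mul_sub hm ht) (fun s hs => ?_)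
    ⟨1, by simp, ?_⟩
  · have h1 := add_mul_sub_pos hm ht ⟨hs.1.le, hs.2⟩
    have h0 := hs.1.le
    gcongr
  · simpa using one_div_lt_one_div_of_lt ht htu

lemma sq_mul_poissonDivergence_div_sq_strictMono {m t u : ℝ} (hm : 0 ≤ m) (ht : 0 < t)
    (htu : t < u) (htm : t ≠ m) (hum : u ≠ m) :
    t ^ 2 * (poissonDivergence m t / (t - m) ^ 2) <
      u ^ 2 * (poissonDivergence m u / (u - m) ^ 2) := by
  have hu := ht.trans htu
  rcases hm.eq_or_lt with rfl | hm
  · have : ∀ x : ℝ, 0 < x → x ^ 2 * (poissonDivergence 0 x / (x - 0) ^ 2) = x := by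
      intro x hx
      simp only [poissonDivergence_zero_left, sub_zero]
      field_simp
    rwa [this t ht, this u hu]
  rw [← integral_div_eq_poissonDivergence_div hm ht htm,
    ← integral_div_eq_poissonDivergence_div hm hu hum, ← intervalIntegral.integral_const_mul,
    ← intervalIntegral.integral_const_mul]
  refine intervalIntegral.integral_lt_integral_of_continuousOn_of_le_of_exists_lt one_pos
    (continuousOn_const.mul (continuousOn_div_add_mul_sub hm ht))
    (continuousOn_const.mul (continuousOn_div_add_mul_sub hm hu)) (fun s hs => ?_)
    ⟨1, by simp, ?_⟩
  · have h1 := add_mul_sub_pos hm ht ⟨hs.1.le, hs.2⟩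
    have h2 := add_mul_sub_pos hm hu ⟨hs.1.le, hs.2⟩
    rw [mul_div_assoc', mul_div_assoc', div_le_div_iff₀ h1 h2]
    -- The difference of the two sides is exactly the sum of the terms in `h4` and `h5`.
    have h3 : t ^ 2 * (m + s * (u - m)) ≤ u ^ 2 * (m + s * (t - m)) := by
      have h4 : 0 ≤ (u ^ 2 - t ^ 2) * (m * (1 - s)) :=
        mul_nonneg (by nlinarith) (mul_nonneg hm.le (by linarith [hs.2]))
      have h5 : 0 ≤ s * (t * u * (u - t)) :=
        mul_nonneg hs.1.le (mul_nonneg (by positivity) (by linarith))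
      nlinarith
    nlinarith [mul_le_mul_of_nonneg_left h3 hs.1.le]
  · have : ∀ x : ℝ, 0 < x → x ^ 2 * (1 / (m + 1 * (x - m))) = x := by
      intro x hx
      simp only [one_mul, add_sub_cancel]
      field_simp
    simpa only [this t ht, this u hu] using htu

lemma tendsto_poissonDivergence_nhdsGT_zero {m : ℝ} (hm : 0 < m) :
    Tendsto (poissonDivergence m) (𝓝[>] 0) atTop := by
  have h : Tendsto (fun t => (m * Real.log m - m) + (-m * Real.log t)) (𝓝[>] 0) atTop :=
    tendsto_atTop_add_const_left _ _
      (Real.tendsto_log_nhdsGT_zero.const_mul_atBot_of_neg (by linarith))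
  refine tendsto_atTop_mono' _ ?_ h
  filter_upwards [self_mem_nhdsWithin] with t (ht : 0 < t)
  rw [poissonDivergence_eq m ht]
  linarith

lemma tendsto_poissonDivergence_atTop {m : ℝ} (hm : 0 ≤ m) :
    Tendsto (poissonDivergence m) atTop atTop := by
  rcases hm.eq_or_lt with rfl | hm
  · exact tendsto_id.congr fun t => (poissonDivergence_zero_left t).symm
  have h : Tendsto (fun t => (m * Real.log m - m * Real.log (2 * m)) + t / 2) atTop atTop :=
    tendsto_atTop_add_const_left _ _ (tendsto_id.atTop_div_const two_pos)
  refine tendsto_atTop_mono' _ ?_ h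
  filter_upwards [eventually_gt_atTop 0] with t ht
  -- The scale 2m makes the logarithm cost at most t/2, leaving t/2 to diverge.
  have h1 := Real.log_le_sub_one_of_pos (x := t / (2 * m)) (by positivity)
  rw [Real.log_div ht.ne' (by positivity)] at h1
  have h2 := mul_le_mul_of_nonneg_left h1 hm.le
  have h3 : m * (t / (2 * m)) = t / 2 := by field_simp
  rw [poissonDivergence_eq m ht]
  nlinarith

/-- The signed square root of twice the divergence between Poisson laws. -/
def poissonSignedRoot (m t : ℝ) : ℝ :=
  if m < t then -√(2 * poissonDivergence m t) else √(2 * poissonDivergence m t)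

lemma poissonSignedRoot_sq {m t : ℝ} (hm : 0 ≤ m) (ht : 0 < t) :
    poissonSignedRoot m t ^ 2 = 2 * poissonDivergence m t := by
  have h : 0 ≤ 2 * poissonDivergence m t := by linarith [poissonDivergence_nonneg hm ht]
  unfold poissonSignedRoot
  split_ifs <;> simp only [neg_sq, Real.sq_sqrt h]

/-- Numerator and signed root have the same sign, so the quotient is positive and the case
distinction at the mean disappears. -/
lemma sub_div_poissonSignedRoot {m t : ℝ} (hm : 0 ≤ m) (ht : 0 < t) (h : t ≠ m) :
    (m - t) / poissonSignedRoot m t = 1 / √(2 * (poissonDivergence m t / (t - m) ^ 2)) := by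
  have hd := poissonDivergence_pos hm ht h
  rw [← mul_div_assoc, Real.sqrt_div (by positivity), Real.sqrt_sq_eq_abs, one_div_div]
  unfold poissonSignedRoot
  split_ifs with hmt
  · rw [abs_of_pos (by linarith), div_neg, ← neg_div, neg_sub]
  · rw [abs_of_nonpos (by linarith), neg_sub]

lemma hasDerivAt_poissonSignedRoot {m t : ℝ} (hm : 0 ≤ m) (ht : 0 < t) (h : t ≠ m) :
    HasDerivAt (poissonSignedRoot m) (-((m - t) / poissonSignedRoot m t / t)) t := by
  have hd := poissonDivergence_pos hm ht h
  have h1 : HasDerivAt (fun t => √(2 * poissonDivergence m t)) _ t :=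
    ((hasDerivAt_poissonDivergence m ht).const_mul 2).sqrt (by positivity)
  rcases lt_or_gt_of_ne h with htm | hmt
  · have hG : poissonSignedRoot m t = √(2 * poissonDivergence m t) := if_neg htm.not_gt
    rw [hG]
    refine (h1.congr_of_eventuallyEq ?_).congr_deriv (by field_simp; ring)
    filter_upwards [gt_mem_nhds htm] with s hs using if_neg hs.not_gt
  · have hG : poissonSignedRoot m t = -√(2 * poissonDivergence m t) := if_pos hmt
    rw [hG]
    refine (h1.neg.congr_of_eventuallyEq ?_).congr_deriv (by field_simp; ring)
    filter_upwards [lt_mem_nhds hmt] with s hs using if_pos hs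

lemma continuousAt_poissonSignedRoot {m t : ℝ} (hm : 0 ≤ m) (ht : 0 < t) :
    ContinuousAt (poissonSignedRoot m) t := by
  rcases eq_or_ne t m with rfl | h
  · have h0 : poissonSignedRoot t t = 0 := by simp [poissonSignedRoot, poissonDivergence_self]
    have h1 : ContinuousAt (fun s => √(2 * poissonDivergence t s)) t :=
      ((hasDerivAt_poissonDivergence t ht).continuousAt.const_mul 2).sqrt
    rw [ContinuousAt, h0]
    rw [ContinuousAt, poissonDivergence_self, mul_zero, Real.sqrt_zero] at h1
    refine squeeze_zero_norm (fun s => ?_) h1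
    unfold poissonSignedRoot
    split_ifs <;> simp [abs_of_nonneg]
  · exact (hasDerivAt_poissonSignedRoot hm ht h).continuousAt

lemma tendsto_poissonSignedRoot_nhdsGT_zero {m : ℝ} (hm : 0 < m) :
    Tendsto (poissonSignedRoot m) (𝓝[>] 0) atTop := by
  refine (Real.tendsto_sqrt_atTop.comp
    ((tendsto_poissonDivergence_nhdsGT_zero hm).const_mul_atTop two_pos)).congr' ?_
  filter_upwards [Ioo_mem_nhdsGT hm] with t ht using (if_neg ht.2.not_gt).symm

lemma tendsto_poissonSignedRoot_zero_nhdsGT_zero :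
    Tendsto (poissonSignedRoot 0) (𝓝[>] 0) (𝓝 0) := by
  have h : Tendsto (fun t : ℝ => -√(2 * t)) (𝓝[>] 0) (𝓝 0) := by
    have : Continuous (fun t : ℝ => -√(2 * t)) := by fun_prop
    simpa using (this.tendsto 0).mono_left nhdsWithin_le_nhds
  refine h.congr' ?_
  filter_upwards [self_mem_nhdsWithin] with t (ht : 0 < t)
  simp [poissonSignedRoot, ht]

lemma tendsto_poissonSignedRoot_atTop {m : ℝ} (hm : 0 ≤ m) :
    Tendsto (poissonSignedRoot m) atTop atBot := by
  refine (tendsto_neg_atTop_atBot.comp (Real.tendsto_sqrt_atTop.comp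
    ((tendsto_poissonDivergence_atTop hm).const_mul_atTop two_pos))).congr' ?_
  filter_upwards [eventually_gt_atTop m] with t ht using (if_pos ht).symm

/-! ### The standard Gaussian distribution function -/

lemma hasDerivAt_cdf_gaussianReal (x : ℝ) :
    HasDerivAt (cdf (gaussianReal 0 1)) (gaussianPDFReal 0 1 x) x := by
  have hint := integrable_gaussianPDFReal 0 1
  have hcdf : ∀ y, cdf (gaussianReal 0 1) y = ∫ z in Set.Iic y, gaussianPDFReal 0 1 z := by
    intro y
    rw [cdf_eq_real, measureReal_def, gaussianReal_apply_eq_integral _ one_ne_zero,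
      ENNReal.toReal_ofReal (integral_nonneg fun z => gaussianPDFReal_nonneg 0 1 z)]
  have hc : Continuous (gaussianPDFReal 0 1) := by
    unfold gaussianPDFReal; fun_prop
  have h := (intervalIntegral.integral_hasDerivAt_right (a := 0) (b := x)
    hint.intervalIntegrable (hc.stronglyMeasurableAtFilter _ _) hc.continuousAt).const_add
      (cdf (gaussianReal 0 1) 0)
  refine h.congr_of_eventuallyEq (.of_forall fun y => ?_)
  simp only [hcdf]
  rw [← intervalIntegral.integral_Iic_sub_Iic hint.integrableOn hint.integrableOn]
  ring

lemma cdf_gaussianReal_pos (x : ℝ) : 0 < cdf (gaussianReal 0 1) x := by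
  have h : StrictMono (cdf (gaussianReal 0 1)) := strictMono_of_deriv_pos fun y => by
    rw [(hasDerivAt_cdf_gaussianReal y).deriv]
    exact gaussianPDFReal_pos 0 1 y one_ne_zero
  exact (cdf_nonneg _ (x - 1)).trans_lt (h (by linarith))

/-! ### Poisson tails as functions of the mean -/

/-- The probability that a Poisson variable with mean `t` is less than `n`. -/
def poissonLT (n : ℕ) (t : ℝ) : ℝ :=
  ∑ k ∈ Finset.range n, Real.exp (-t) * t ^ k / (k.factorial : ℝ)

/-- The derivatives of consecutive terms telescope, leaving only the last one. -/
lemma hasDerivAt_poissonLT (n : ℕ) (t : ℝ) :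
    HasDerivAt (poissonLT (n + 1)) (-(Real.exp (-t) * t ^ n / (n.factorial : ℝ))) t := by
  have he : HasDerivAt (fun t : ℝ => Real.exp (-t)) (-Real.exp (-t)) t := by
    simpa using (hasDerivAt_neg t).exp
  induction n with
  | zero =>
    have heq : poissonLT (0 + 1) = fun t : ℝ => Real.exp (-t) := by
      funext s; simp [poissonLT]
    simpa [heq] using he
  | succ n ih =>
    have h : HasDerivAt (fun t : ℝ => poissonLT (n + 1) t +
        Real.exp (-t) * t ^ (n + 1) / ((n + 1).factorial : ℝ)) _ t :=
      ih.add ((he.mul (hasDerivAt_pow (n + 1) t)).div_const _)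
    have heq : poissonLT (n + 1 + 1) = fun t : ℝ => poissonLT (n + 1) t +
        Real.exp (-t) * t ^ (n + 1) / ((n + 1).factorial : ℝ) := by
      funext s
      exact Finset.sum_range_succ _ _
    rw [heq]
    refine h.congr_deriv ?_
    rw [Nat.factorial_succ]
    push_cast
    have : (n.factorial : ℝ) ≠ 0 := by positivity
    field_simp
    ring

lemma tendsto_poissonLT_nhdsGT_zero (n : ℕ) :
    Tendsto (poissonLT (n + 1)) (𝓝[>] 0) (𝓝 1) := by
  have h := (hasDerivAt_poissonLT n 0).continuousAt.tendsto
  have h1 : poissonLT (n + 1) 0 = 1 := by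
    simp [poissonLT, Finset.sum_range_succ']
  rw [h1] at h
  exact h.mono_left nhdsWithin_le_nhds

lemma tendsto_poissonLT_atTop (n : ℕ) : Tendsto (poissonLT n) atTop (𝓝 0) := by
  have h : Tendsto (fun t : ℝ => ∑ k ∈ Finset.range n,
      Real.exp (-t) * t ^ k / (k.factorial : ℝ)) atTop
      (𝓝 (∑ k ∈ Finset.range n, 0 / (k.factorial : ℝ))) :=
    tendsto_finsetSum _ fun k _ => by
      simpa [mul_comm] using
        (Real.tendsto_pow_mul_exp_neg_atTop_nhds_zero k).div_const (k.factorial : ℝ)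
  simp only [zero_div, Finset.sum_const_zero] at h
  exact h

/-! ### Comparison of the Poisson tails with the Gaussian distribution function -/

/-- Since G²/2 is the divergence, the Gaussian exponent is a Poisson log-likelihood up to a
constant. This common factor is what makes the two derivatives comparable. -/
lemma gaussianPDFReal_poissonSignedRoot (n : ℕ) {t : ℝ} (ht : 0 < t) :
    gaussianPDFReal 0 1 (poissonSignedRoot n t) =
      (√(2 * Real.pi))⁻¹ * Real.exp n / (n : ℝ) ^ n * (Real.exp (-t) * t ^ n) := by
  have h1 : Real.exp (n * Real.log t) = t ^ n := by
    rw [← Real.log_pow, Real.exp_log (by positivity)]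
  have h2 : Real.exp (n * Real.log n) = (n : ℝ) ^ n := by
    rcases n.eq_zero_or_pos with rfl | hn
    · simp
    · rw [← Real.log_pow, Real.exp_log (by positivity)]
  have h3 : -(poissonSignedRoot n t - 0) ^ 2 / (2 * ((1 : ℝ≥0) : ℝ)) =
      n + -t + n * Real.log t - n * Real.log n := by
    rw [sub_zero, poissonSignedRoot_sq n.cast_nonneg ht, poissonDivergence_eq _ ht, NNReal.coe_one]
    ring
  rw [gaussianPDFReal, h3, Real.exp_sub, Real.exp_add, Real.exp_add, h1, h2, NNReal.coe_one,
    mul_one]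
  ring

lemma hasDerivAt_cdf_poissonSignedRoot (n : ℕ) {t : ℝ} (ht : 0 < t) (h : t ≠ n) :
    HasDerivAt (fun t => cdf (gaussianReal 0 1) (poissonSignedRoot n t))
      ((√(2 * Real.pi))⁻¹ * Real.exp n / (n : ℝ) ^ n * (Real.exp (-t) * t ^ n) *
        -(1 / √(2 * (poissonDivergence n t / (t - n) ^ 2)) / t)) t := by
  rw [← gaussianPDFReal_poissonSignedRoot n ht, ← sub_div_poissonSignedRoot n.cast_nonneg ht h]
  exact (hasDerivAt_cdf_gaussianReal _).comp t (hasDerivAt_poissonSignedRoot n.cast_nonneg ht h)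

lemma continuousOn_cdf_poissonSignedRoot (n : ℕ) :
    ContinuousOn (fun t => cdf (gaussianReal 0 1) (poissonSignedRoot n t)) (Set.Ioi 0) :=
  fun t ht => ((hasDerivAt_cdf_gaussianReal (poissonSignedRoot n t)).continuousAt.comp
    (continuousAt_poissonSignedRoot n.cast_nonneg ht)).continuousWithinAt

lemma continuous_poissonLT (n : ℕ) : Continuous (poissonLT n) := by
  unfold poissonLT; fun_prop

lemma tendsto_cdf_poissonSignedRoot_atTop (n : ℕ) :
    Tendsto (fun t => cdf (gaussianReal 0 1) (poissonSignedRoot n t)) atTop (𝓝 0) :=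
  (tendsto_cdf_atBot _).comp (tendsto_poissonSignedRoot_atTop n.cast_nonneg)

lemma tendsto_cdf_poissonSignedRoot_nhdsGT_zero {n : ℕ} (hn : 0 < n) :
    Tendsto (fun t => cdf (gaussianReal 0 1) (poissonSignedRoot n t)) (𝓝[>] 0) (𝓝 1) :=
  (tendsto_cdf_atTop _).comp (tendsto_poissonSignedRoot_nhdsGT_zero (Nat.cast_pos.2 hn))

lemma poissonLT_lt_cdf_poissonSignedRoot (n : ℕ) {t : ℝ} (ht : 0 < t) :
    poissonLT n t < cdf (gaussianReal 0 1) (poissonSignedRoot n t) := by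
  rcases n with _ | k
  · simpa [poissonLT] using cdf_gaussianReal_pos _
  have hk : (0 : ℝ) < (k + 1 : ℕ) := by positivity
  set C : ℝ := (√(2 * Real.pi))⁻¹ * Real.exp (k + 1 : ℕ) / ((k + 1 : ℕ) : ℝ) ^ (k + 1) with hC
  have hC0 : 0 < C := by positivity
  have hinf := (tendsto_cdf_poissonSignedRoot_atTop (k + 1)).sub (tendsto_poissonLT_atTop (k + 1))
  rw [sub_zero] at hinf
  refine sub_pos.1 (pos_of_hasDerivAt_mul_sub (c := (k + 1 : ℕ)) (L := 1 - 1)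
    (H := fun t => cdf (gaussianReal 0 1) (poissonSignedRoot (k + 1 : ℕ) t) - poissonLT (k + 1) t)
    (w := fun t => Real.exp (-t) * t ^ k) (A := 1 / (k.factorial : ℝ))
    (f := fun t => C * (1 / √(2 * (poissonDivergence (k + 1 : ℕ) t / (t - (k + 1 : ℕ)) ^ 2))))
    ((continuousOn_cdf_poissonSignedRoot _).sub (continuous_poissonLT _).continuousOn)
    (fun s hs hsm => ?_) (fun s hs => by positivity) (fun s u hs hsu hsm hum => ?_)
    ((tendsto_cdf_poissonSignedRoot_nhdsGT_zero k.succ_pos).sub (tendsto_poissonLT_nhdsGT_zero k))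
    (by simp) hinf ht)
  · refine ((hasDerivAt_cdf_poissonSignedRoot (k + 1) hs hsm).sub
      (hasDerivAt_poissonLT k s)).congr_deriv ?_
    rw [← hC, pow_succ]
    field_simp
    ring
  · have h1 := poissonDivergence_div_sq_strictAnti hk hs hsu hsm hum
    have h2 : 0 < poissonDivergence (k + 1 : ℕ) u / (u - (k + 1 : ℕ)) ^ 2 :=
      div_pos (poissonDivergence_pos hk.le (hs.trans hsu) hum) (by
        have := sub_ne_zero.2 hum; positivity)
    gcongr

lemma cdf_poissonSignedRoot_lt_poissonLT (n : ℕ) {t : ℝ} (ht : 0 < t) :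
    cdf (gaussianReal 0 1) (poissonSignedRoot n t) < poissonLT (n + 1) t := by
  set C : ℝ := (√(2 * Real.pi))⁻¹ * Real.exp n / (n : ℝ) ^ n with hC
  have hC0 : 0 < C := by
    rcases n.eq_zero_or_pos with rfl | hn <;> simp only [hC] <;> [simp; positivity]
    positivity
  -- For `n = 0` the root tends to 0 rather than to ∞, so the Gaussian limit is Φ(0); only `L ≤ 1`
  -- matters.
  obtain ⟨L, hL, hL0⟩ : ∃ L, Tendsto (fun t => poissonLT (n + 1) t -
      cdf (gaussianReal 0 1) (poissonSignedRoot n t)) (𝓝[>] 0) (𝓝 (1 - L)) ∧ L ≤ 1 := by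
    rcases n.eq_zero_or_pos with rfl | hn
    · refine ⟨_, (tendsto_poissonLT_nhdsGT_zero 0).sub
        ((hasDerivAt_cdf_gaussianReal 0).continuousAt.tendsto.comp ?_), cdf_le_one _ _⟩
      simpa using tendsto_poissonSignedRoot_zero_nhdsGT_zero
    · exact ⟨1, (tendsto_poissonLT_nhdsGT_zero n).sub
        (tendsto_cdf_poissonSignedRoot_nhdsGT_zero hn), le_rfl⟩
  have hinf := (tendsto_poissonLT_atTop (n + 1)).sub (tendsto_cdf_poissonSignedRoot_atTop n)
  rw [sub_zero] at hinf
  refine sub_pos.1 (pos_of_hasDerivAt_mul_sub (c := n) (L := 1 - L)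
    (H := fun t => poissonLT (n + 1) t - cdf (gaussianReal 0 1) (poissonSignedRoot n t))
    (w := fun t => Real.exp (-t) * t ^ n) (A := -(1 / (n.factorial : ℝ)))
    -- With weight e^{-t} t^n a factor 1/t is left over; it enters the root as t² and reverses the
    -- monotonicity, which the minus sign corrects.
    (f := fun t => -(C * (1 / √(2 * (t ^ 2 * (poissonDivergence n t / (t - n) ^ 2))))))
    ((continuous_poissonLT _).continuousOn.sub (continuousOn_cdf_poissonSignedRoot _))
    (fun s hs hsm => ?_) (fun s hs => by positivity) (fun s u hs hsu hsm hum => ?_) hL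
    (by linarith) hinf ht)
  · refine ((hasDerivAt_poissonLT n s).sub
      (hasDerivAt_cdf_poissonSignedRoot n hs hsm)).congr_deriv ?_
    rw [← hC, mul_left_comm 2 (s ^ 2), Real.sqrt_mul (sq_nonneg s), Real.sqrt_sq hs.le,
      mul_comm s, ← div_div]
    ring
  · have h1 := sq_mul_poissonDivergence_div_sq_strictMono n.cast_nonneg hs hsu hsm hum
    have h2 : 0 < s ^ 2 * (poissonDivergence n s / (s - n) ^ 2) :=
      mul_pos (by positivity) (div_pos (poissonDivergence_pos n.cast_nonneg hs hsm) (by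
        have := sub_ne_zero.2 hsm; positivity))
    gcongr

end

/-! ### Poisson laws on the real line -/

noncomputable section

/-- The Poisson law with mean `t`, as a measure on the real line. -/
def poissonReal (t : ℝ≥0) : Measure ℝ := (poissonMeasure t).map (Nat.cast : ℕ → ℝ)

instance (t : ℝ≥0) : IsProbabilityMeasure (poissonReal t) :=
  Measure.isProbabilityMeasure_map .of_discrete

lemma poissonReal_apply (t : ℝ≥0) {s : Set ℝ} (hs : MeasurableSet s) :
    poissonReal t s = poissonMeasure t (Nat.cast ⁻¹' s) :=
  Measure.map_apply .of_discrete hs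

lemma poissonReal_natCast (t : ℝ≥0) (n : ℕ) :
    poissonReal t {(n : ℝ)} = ENNReal.ofReal (Real.exp (-t) * t ^ n / n.factorial) := by
  rw [poissonReal_apply t (measurableSet_singleton _), ← poissonMeasure_singleton]
  congr 1
  ext k
  simp

lemma poissonReal_compl_range (t : ℝ≥0) :
    poissonReal t (Set.range (Nat.cast : ℕ → ℝ))ᶜ = 0 := by
  rw [poissonReal_apply t (Set.countable_range _).measurableSet.compl, Set.preimage_compl,
    Set.preimage_range, Set.compl_univ, measure_empty]

lemma hasSum_poisson_mul_natCast (t : ℝ≥0) :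
    HasSum (fun n : ℕ => Real.exp (-t) * t ^ n / n.factorial * (n : ℝ)) t := by
  rw [← hasSum_nat_add_iff' 1]
  convert! (hasSum_one_poissonMeasure t).mul_left (t : ℝ) using 1
  · funext n
    rw [Nat.factorial_succ]
    push_cast
    field_simp
    ring
  · simp

lemma integrable_id_poissonReal (t : ℝ≥0) : Integrable (fun y => y) (poissonReal t) := by
  rw [poissonReal, integrable_map_measure (by fun_prop) .of_discrete,
    integrable_poissonMeasure_iff]
  simpa using (hasSum_poisson_mul_natCast t).summable

lemma integral_id_poissonReal (t : ℝ≥0) : ∫ y, y ∂poissonReal t = t := by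
  rw [poissonReal, integral_map .of_discrete (by fun_prop), integral_poissonMeasure]
  exact (hasSum_poisson_mul_natCast t).tsum_eq

lemma hasSum_poisson_mul_exp (t : ℝ≥0) (β : ℝ) :
    HasSum (fun n : ℕ => Real.exp (-t) * t ^ n / n.factorial * Real.exp (β * n))
      (Real.exp (t * Real.exp β - t)) := by
  convert! (NormedSpace.expSeries_div_hasSum_exp (t * Real.exp β)).mul_left (Real.exp (-t)) using 1
  · funext n
    rw [mul_comm β, Real.exp_nat_mul, mul_pow]
    ring
  · rw [← Real.exp_eq_exp_ℝ, ← Real.exp_add]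
    ring_nf

lemma integrable_exp_mul_poissonReal (t : ℝ≥0) (β : ℝ) :
    Integrable (fun x => Real.exp (β * x)) (poissonReal t) := by
  rw [poissonReal, integrable_map_measure (by fun_prop) .of_discrete,
    integrable_poissonMeasure_iff]
  simpa using (hasSum_poisson_mul_exp t β).summable

lemma integral_exp_mul_poissonReal (t : ℝ≥0) (β : ℝ) :
    ∫ x, Real.exp (β * x) ∂poissonReal t = Real.exp (t * Real.exp β - t) := by
  rw [poissonReal, integral_map .of_discrete (by fun_prop), integral_poissonMeasure]
  exact (hasSum_poisson_mul_exp t β).tsum_eq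

/-- The density of the Poisson law with mean `x` relative to the one with mean `t`. -/
def poissonDensity (x t y : ℝ) : ℝ := Real.exp (t - x) * (x / t) ^ y

lemma measurable_poissonDensity (x t : ℝ) : Measurable (poissonDensity x t) := by
  unfold poissonDensity; fun_prop

lemma poissonReal_eq_withDensity (x : ℝ≥0) {t : ℝ≥0} (ht : 0 < t) :
    poissonReal x = (poissonReal t).withDensity fun y => ENNReal.ofReal (poissonDensity x t y) := by
  have h : poissonMeasure x = (poissonMeasure t).withDensity
      fun n => ENNReal.ofReal (poissonDensity x t n) := by
    refine Measure.ext_of_singleton fun n => ?_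
    rw [withDensity_apply _ (measurableSet_singleton n), lintegral_singleton,
      poissonMeasure_singleton, poissonMeasure_singleton,
      ← ENNReal.ofReal_mul (by unfold poissonDensity; positivity)]
    congr 1
    have ht' : (t : ℝ) ≠ 0 := by exact_mod_cast ht.ne'
    rw [poissonDensity, Real.rpow_natCast, div_pow, sub_eq_add_neg, Real.exp_add, Real.exp_neg t]
    field_simp
  ext s hs
  have hm := measurable_poissonDensity x t
  rw [withDensity_apply _ hs, poissonReal_apply x hs, poissonReal,
    setLIntegral_map hs (by fun_prop) .of_discrete, h, withDensity_apply _ .of_discrete]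

lemma tilted_poissonReal (β : ℝ) {t : ℝ≥0} (ht : 0 < t) :
    (poissonReal t).tilted (fun x => β * x) = poissonReal (t * (Real.exp β).toNNReal) := by
  rw [poissonReal_eq_withDensity (t * (Real.exp β).toNNReal) ht, Measure.tilted,
    integral_exp_mul_poissonReal]
  congr 1
  funext y
  have ht' : (t : ℝ) ≠ 0 := by exact_mod_cast ht.ne'
  rw [poissonDensity, NNReal.coe_mul, Real.coe_toNNReal _ (Real.exp_nonneg β), mul_div_cancel_left₀ _ ht', ← Real.exp_mul,
    ← Real.exp_add, ← Real.exp_sub]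
  ring_nf

lemma klDiv_poissonReal (x : ℝ≥0) {t : ℝ≥0} (ht : 0 < t) :
    InformationTheory.klDiv (poissonReal x) (poissonReal t) =
      ENNReal.ofReal (poissonDivergence x t) := by
  have hac : poissonReal x ≪ poissonReal t := by
    rw [poissonReal_eq_withDensity x ht]
    exact withDensity_absolutelyContinuous _ _
  have hrn : (poissonReal x).rnDeriv (poissonReal t) =ᵐ[poissonReal t]
      fun y => ENNReal.ofReal (poissonDensity x t y) := by
    have hm := measurable_poissonDensity x t
    conv_lhs => rw [poissonReal_eq_withDensity x ht]
    exact Measure.rnDeriv_withDensity _ (by fun_prop)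
  have hlog : ∀ᵐ y ∂poissonReal x, Real.log (ENNReal.ofReal (poissonDensity x t y)).toReal =
      (t - x : ℝ) + y * Real.log (x / t) := by
    -- For `x = 0` the affine formula for the log-density holds only at y = 0, which carries all the
    -- mass.
    rcases eq_zero_or_pos x with rfl | hx
    · have h0 : poissonReal 0 {((0 : ℕ) : ℝ)}ᶜ = 0 := by
        rw [prob_compl_eq_one_sub (measurableSet_singleton _), poissonReal_natCast]
        simp
      filter_upwards [compl_mem_ae_iff.2 h0] with y hy
      obtain rfl : y = 0 := by simpa using hy
      simp [poissonDensity, ENNReal.toReal_ofReal, Real.exp_nonneg]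
    · have hx' := NNReal.coe_pos.2 hx
      have ht' := NNReal.coe_pos.2 ht
      refine .of_forall fun y => ?_
      rw [ENNReal.toReal_ofReal (by unfold poissonDensity; positivity), poissonDensity,
        Real.log_mul (by positivity) (by positivity), Real.log_exp, Real.log_rpow (by positivity)]
  have hllr : llr (poissonReal x) (poissonReal t) =ᵐ[poissonReal x]
      fun y => (t - x : ℝ) + y * Real.log (x / t) := by
    filter_upwards [hac.ae_le hrn, hlog] with y hy hy'
    rw [llr, hy, hy']
  have hint : Integrable (fun y => (t - x : ℝ) + y * Real.log (x / t)) (poissonReal x) :=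
    (integrable_const _).add ((integrable_id_poissonReal x).mul_const _)
  rw [InformationTheory.klDiv_of_ac_of_integrable hac (hint.congr hllr.symm),
    integral_congr_ae hllr, integral_add (integrable_const _)
      ((integrable_id_poissonReal x).mul_const _), integral_mul_const, integral_id_poissonReal]
  simp only [integral_const, probReal_univ, smul_eq_mul, one_mul, poissonDivergence]
  ring_nf

/-! ### The exponential family based on a Poisson law -/

/-- The mass off 0 is 1 - e^{-t}, which vanishes; this bounds every set avoiding 0, and complements
give the others. -/
lemma tendsto_poissonReal_nhds_zero {s : Set ℝ} (hs : MeasurableSet s) :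
    Tendsto (fun t => poissonReal t s) (𝓝 0) (𝓝 (poissonReal 0 s)) := by
  have h0 : ∀ t : ℝ≥0, poissonReal t {(0 : ℝ)}ᶜ = 1 - ENNReal.ofReal (Real.exp (-t)) := fun t => by
    have := poissonReal_natCast t 0
    rw [Nat.cast_zero] at this
    rw [prob_compl_eq_one_sub (measurableSet_singleton _), this]
    simp
  have hlim : Tendsto (fun t : ℝ≥0 => poissonReal t {(0 : ℝ)}ᶜ) (𝓝 0) (𝓝 0) := by
    simp_rw [h0]
    have h1 : Tendsto (fun t : ℝ≥0 => ENNReal.ofReal (Real.exp (-t))) (𝓝 0) (𝓝 1) := by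
      have : Continuous fun t : ℝ≥0 => ENNReal.ofReal (Real.exp (-t)) :=
        ENNReal.continuous_ofReal.comp (by fun_prop)
      simpa using this.tendsto 0
    simpa using ENNReal.Tendsto.sub tendsto_const_nhds h1 (.inl ENNReal.one_ne_top)
  have key : ∀ u : Set ℝ, (0 : ℝ) ∉ u → Tendsto (fun t => poissonReal t u) (𝓝 0) (𝓝 0) :=
    fun u hu => tendsto_of_tendsto_of_tendsto_of_le_of_le tendsto_const_nhds hlim
      (fun _ => zero_le) fun t => measure_mono fun x hx h => hu (h ▸ hx)
  have key0 : ∀ u : Set ℝ, (0 : ℝ) ∉ u → poissonReal 0 u = 0 := fun u hu =>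
    measure_mono_null (t := {(0 : ℝ)}ᶜ) (fun x hx h => hu (h ▸ hx)) (by simp [h0])
  by_cases hs0 : (0 : ℝ) ∈ s
  · have hc : ∀ t, poissonReal t s = 1 - poissonReal t sᶜ := fun t => by
      rw [← prob_compl_eq_one_sub hs.compl, compl_compl]
    simp_rw [hc, key0 sᶜ (fun h => h hs0)]
    exact ENNReal.Tendsto.sub tendsto_const_nhds (key _ fun h => h hs0) (.inl ENNReal.one_ne_top)
  · rw [key0 s hs0]
    exact key s hs0

lemma tendsto_tilted_poissonReal_atBot {t : ℝ≥0} (ht : 0 < t) {s : Set ℝ} (hs : MeasurableSet s) :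
    Tendsto (fun β : ℝ => (poissonReal t).tilted (fun x => β * x) s) atBot
      (𝓝 (poissonReal 0 s)) := by
  simp_rw [tilted_poissonReal _ ht]
  refine (tendsto_poissonReal_nhds_zero hs).comp ?_
  rw [← NNReal.tendsto_coe]
  simpa [Real.exp_nonneg] using Real.tendsto_exp_atBot.const_mul (t : ℝ)

/-- Tilting by β multiplies the mean by e^β, so tilts reach all positive means and β → -∞ adds mean
0. As β → ∞ the mass escapes: a setwise limit would vanish on each natural number and off the
naturals, hence not be a probability measure. -/
lemma isExpFamilyMember_poissonReal_iff {t : ℝ≥0} (ht : 0 < t) (Q : Measure ℝ) :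
    IsExpFamilyMember (poissonReal t) Q ↔ ∃ x : ℝ≥0, Q = poissonReal x := by
  constructor
  · rintro ⟨hQ, ⟨β, -, rfl⟩ | h | h⟩
    · exact ⟨_, tilted_poissonReal β ht⟩
    · refine ⟨0, Measure.ext fun s hs => ?_⟩
      exact tendsto_nhds_unique (h s hs) (tendsto_tilted_poissonReal_atBot ht hs)
    · exfalso
      simp_rw [tilted_poissonReal _ ht] at h
      have hpt : ∀ n : ℕ, Q {(n : ℝ)} = 0 := by
        intro n
        refine tendsto_nhds_unique (h _ (measurableSet_singleton _)) ?_
        simp_rw [poissonReal_natCast]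
        have h1 : Tendsto (fun x : ℝ => Real.exp (-x) * x ^ n / n.factorial) atTop (𝓝 0) := by
          simpa [mul_comm] using
            (Real.tendsto_pow_mul_exp_neg_atTop_nhds_zero n).div_const (n.factorial : ℝ)
        have h2 := ENNReal.tendsto_ofReal (h1.comp
          (Real.tendsto_exp_atTop.const_mul_atTop (NNReal.coe_pos.2 ht)))
        simpa [Real.exp_nonneg] using h2
      have hrange : Q (Set.range (Nat.cast : ℕ → ℝ))ᶜ = 0 := by
        refine tendsto_nhds_unique (h _ (Set.countable_range _).measurableSet.compl) ?_
        simp_rw [poissonReal_compl_range]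
        exact tendsto_const_nhds
      have hrange' : Q (Set.range (Nat.cast : ℕ → ℝ)) = 0 := by
        rw [← Set.iUnion_singleton_eq_range]
        exact measure_iUnion_null hpt
      have := measure_univ_le_add_compl (μ := Q) (Set.range (Nat.cast : ℕ → ℝ))
      simp [hrange, hrange'] at this
  · rintro ⟨x, rfl⟩
    refine ⟨inferInstance, ?_⟩
    rcases eq_zero_or_pos x with rfl | hx
    · exact .inr (.inl fun s hs => tendsto_tilted_poissonReal_atBot ht hs)
    · refine .inl ⟨Real.log (x / t), integrable_exp_mul_poissonReal t _, ?_⟩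
      rw [tilted_poissonReal _ ht]
      congr 1
      have hx' := NNReal.coe_pos.2 hx
      have ht' := NNReal.coe_pos.2 ht
      ext
      rw [NNReal.coe_mul, Real.coe_toNNReal _ (Real.exp_nonneg _), Real.exp_log (by positivity)]
      field_simp

/-- A Poisson law is determined by its mean, so the infimum runs over a single law. -/
lemma divergenceAtMean_poissonReal (x : ℝ≥0) {t : ℝ≥0} (ht : 0 < t) :
    divergenceAtMean (poissonReal t) x = ENNReal.ofReal (poissonDivergence x t) := by
  rw [← klDiv_poissonReal x ht, divergenceAtMean]
  refine le_antisymm ?_ ?_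
  · exact iInf₂_le_of_le _ ((isExpFamilyMember_poissonReal_iff ht _).2 ⟨x, rfl⟩)
      (iInf₂_le_of_le (integrable_id_poissonReal x) (integral_id_poissonReal x) le_rfl)
  · refine le_iInf₂ fun Q hQ => le_iInf₂ fun _ hmean => ?_
    obtain ⟨y, rfl⟩ := (isExpFamilyMember_poissonReal_iff ht _).1 hQ
    rw [integral_id_poissonReal, NNReal.coe_inj] at hmean
    rw [hmean]

lemma divergenceAtMean_poissonReal_of_neg {x : ℝ} (hx : x < 0) {t : ℝ≥0} (ht : 0 < t) :
    divergenceAtMean (poissonReal t) x = ⊤ := by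
  simp only [divergenceAtMean, iInf_eq_top]
  intro Q hQ _ hmean
  obtain ⟨y, rfl⟩ := (isExpFamilyMember_poissonReal_iff ht _).1 hQ
  rw [integral_id_poissonReal] at hmean
  exact absurd hx (hmean ▸ y.coe_nonneg : 0 ≤ x).not_gt

lemma gTransform_poissonReal_natCast (n : ℕ) {t : ℝ≥0} (ht : 0 < t) :
    gTransform (poissonReal t) n = (poissonSignedRoot n t : EReal) := by
  have hd := divergenceAtMean_poissonReal (n : ℝ≥0) ht
  have hpos : 0 ≤ poissonDivergence n t := poissonDivergence_nonneg n.cast_nonneg ht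
  have hroot : (((2 * divergenceAtMean (poissonReal t) n) ^ (1 / 2 : ℝ) : ℝ≥0∞) : EReal) =
      (√(2 * poissonDivergence n t) : ℝ) := by
    rw [NNReal.coe_natCast] at hd
    rw [hd, ← ENNReal.ofReal_ofNat 2, ← ENNReal.ofReal_mul zero_le_two,
      ENNReal.ofReal_rpow_of_nonneg (by positivity) (by norm_num), ← Real.sqrt_eq_rpow,
      EReal.coe_ennreal_ofReal, max_eq_left (Real.sqrt_nonneg _)]
  rw [gTransform, integral_id_poissonReal, hroot, poissonSignedRoot]
  split_ifs <;> simp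

lemma gTransform_poissonReal_of_neg {x : ℝ} (hx : x < 0) {t : ℝ≥0} (ht : 0 < t) :
    gTransform (poissonReal t) x = ⊥ := by
  rw [gTransform, integral_id_poissonReal, divergenceAtMean_poissonReal_of_neg hx ht,
    if_pos (hx.trans_le t.coe_nonneg)]
  simp

lemma stdGaussianCDF_coe (x : ℝ) : stdGaussianCDF x = cdf (gaussianReal 0 1) x := by
  simp [stdGaussianCDF, cdf_eq_real, Set.Iic]

lemma stdGaussianCDF_bot : stdGaussianCDF ⊥ = 0 := by
  simp [stdGaussianCDF]

lemma poissonMeasure_real_range (n : ℕ) (t : ℝ≥0) :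
    (poissonMeasure t).real (Finset.range n : Set ℕ) = poissonLT n t := by
  rw [← sum_measureReal_singleton]
  simp_rw [poissonMeasure_real_singleton, poissonLT]

lemma poissonReal_real_Iio (n : ℕ) (t : ℝ≥0) :
    (poissonReal t).real (Set.Iio (n : ℝ)) = poissonLT n t := by
  rw [← poissonMeasure_real_range, measureReal_def, poissonReal_apply t measurableSet_Iio,
    ← measureReal_def]
  congr 1
  ext k
  simp

lemma poissonReal_real_Iic (n : ℕ) (t : ℝ≥0) :
    (poissonReal t).real (Set.Iic (n : ℝ)) = poissonLT (n + 1) t := by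
  rw [← poissonMeasure_real_range, measureReal_def, poissonReal_apply t measurableSet_Iic,
    ← measureReal_def]
  congr 1
  ext k
  simp

lemma poissonReal_real_Iio_of_neg {x : ℝ} (hx : x < 0) (t : ℝ≥0) :
    (poissonReal t).real (Set.Iio x) = 0 := by
  refine measureReal_mono_null (s₂ := Set.Iio ((0 : ℕ) : ℝ))
    (Set.Iio_subset_Iio (by simpa using hx.le)) ?_
  rw [poissonReal_real_Iio]
  simp [poissonLT]

end

theorem mainTheorem2 {Ω : Type*} [MeasurableSpace Ω] (P : Measure Ω) [IsProbabilityMeasure P]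
    (M : Ω → ℝ) (t : ℝ≥0) (ht : 0 < t)
    (hM : HasLaw M ((poissonMeasure t).map (Nat.cast : ℕ → ℝ)) P) :
    (∀ m : ℤ,
      P.real {ω | M ω < m} ≤ stdGaussianCDF (gTransform (P.map M) m) ∧
      stdGaussianCDF (gTransform (P.map M) m) ≤ P.real {ω | M ω ≤ m}) ∧
    (∀ m : ℤ, 0 ≤ m →
      P.real {ω | M ω < m} < stdGaussianCDF (gTransform (P.map M) m) ∧
      stdGaussianCDF (gTransform (P.map M) m) < P.real {ω | M ω ≤ m}) := by
  have hlt : ∀ x : ℝ, P.real {ω | M ω < x} = (poissonReal t).real (Set.Iio x) := fun x =>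
    hM.measureReal_eq measurableSet_Iio
  have hle : ∀ x : ℝ, P.real {ω | M ω ≤ x} = (poissonReal t).real (Set.Iic x) := fun x =>
    hM.measureReal_eq measurableSet_Iic
  have hmap : P.map M = poissonReal t := hM.map_eq
  have strict : ∀ m : ℤ, 0 ≤ m →
      P.real {ω | M ω < m} < stdGaussianCDF (gTransform (P.map M) m) ∧
      stdGaussianCDF (gTransform (P.map M) m) < P.real {ω | M ω ≤ m} := by
    intro m hm
    lift m to ℕ using hm
    rw [hlt, hle, hmap, Int.cast_natCast, gTransform_poissonReal_natCast m ht, stdGaussianCDF_coe,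
      poissonReal_real_Iio, poissonReal_real_Iic]
    exact ⟨poissonLT_lt_cdf_poissonSignedRoot m ht, cdf_poissonSignedRoot_lt_poissonLT m ht⟩
  refine ⟨fun m => ?_, strict⟩
  rcases le_or_gt 0 m with hm | hm
  · exact ⟨(strict m hm).1.le, (strict m hm).2.le⟩
  · have hm' : (m : ℝ) < 0 := by exact_mod_cast hm
    rw [hlt, hmap, gTransform_poissonReal_of_neg hm' ht, stdGaussianCDF_bot,
      poissonReal_real_Iio_of_neg hm']
    exact ⟨le_rfl, measureReal_nonneg⟩
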